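/- **Setting.** A one-mode state is described by its Wigner function on the phase space of points $(x,p)$. The coherent state $|z_0\rangle$, $z_0=(x_0,p_0)$, has wave function $\pi^{-1/4}e^{-(x-x_0)^2/2+ip_0x}$ (up to a phase), and the Wigner function of a wave function $\psi$ is $W(x,p)=\frac1\pi\int e^{2ipy}\psi(x-y)\overline{\psi(x+y)}\,dy$. A homodyne measurement under angle $\theta$ returns a value distributed as the marginal of $W$ along $x_\theta=x\cos\theta+p\sin\theta$. The two-mode squeezed vacuum with parameter $\zeta\ge0$ on modes $A,B$ is the centred Gaussian state with Wigner function $\pi^{-2}\exp(-\mathbf r^T\Gamma(\zeta)^{-1}\mathbf r)$, $\mathbf r=(x_a,p_a,x_b,p_b)$, $\Gamma(\zeta)=\begin{pmatrix}\cosh(2\zeta)\mathbb 1&\sinh(2\zeta)Z\\ \sinh(2\zeta)Z&\cosh(2\zeta)\mathbb 1\end{pmatrix}$, $Z=\mathrm{diag}(1,-1)$. The ideal EPR pair has the (non-normalizable) Wigner distribution $C\,\delta(x_a-x_b)\delta(p_a+p_b)$, $C>0$; laws of measurement results on it are understood conditionally on the teleportation outcome. **Protocol (one round).** For an angle $\theta$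 and $r,r^\perp\in\mathbb R$, verifier $V_1$ sends the coherent state with $(x_0,p_0)=(r\cos\theta+r^\perp\sin\theta,\ r\sin\theta-r^\perp\cos\theta)$ and $V_2$ sends $\theta$. The prover homodynes under $\theta$ and sends the result $r'$ to both verifiers. Over a channel with attenuation $t\in[0,1]$ and excess noise $u\ge0$ the prover receives the Gaussian state with displacement $\sqrt t\,(x_0,p_0)$ and covariance matrix $(1+2u)\mathbb 1$. After $n$ rounds the verifiers accept if the answers arrive on time, both hear the same values, and $\frac1n\sum_i\frac{(r_i'-r_i\sqrt t)^2}{1/2+u}<1+\frac2{\sqrt n}\sqrt{\ln\frac1\varepsilon}+\frac2n\ln\frac1\varepsilon$, where $\varepsilon\in(0,1)$. **Attack (one round, one pre-shared pair).** Alice mixes the intercepted state $\psi$ with her mode $A$ on a balanced beamsplitter with outputs $(\psi+A)/\sqrt2$, $(-\psi+A)/\sqrt2$. She measures $p$ in the first output (outcome $m_p$) and $x$ in the second (outcome $m_x$), and forwards $(d_x,d_p)=(\sqrt2\,m_x,-\sqrt2\,m_p)$ to Bob. Bob intercepts $\theta$, homodynes his mode $B$ under $\theta$ with outcome $\mu$,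 and forwards $(\theta,\mu)$ to Alice. Alice answers $r'=\mu-d_x\cos\theta-d_p\sin\theta$ to $V_1$, and Bob answers the same expression to $V_2$. To imitate a channel $(t,u)$, one attacker also draws an independent $\xi\sim\mathcal N(0,\frac{1-t}2+u)$ and forwards it, and both answer $\sqrt t\,r'+\xi$. **Theorem.** 1. As $\zeta\to\infty$, $\frac\pi2e^{2\zeta}$ times the Wigner function of the two-mode squeezed vacuum converges to $\delta(x_a-x_b)\delta(p_a+p_b)$ when tested against continuous compactly supported functions. 2. For all $\theta,r,r^\perp$ and $C>0$: the honest noiseless answer has law $\mathcal N(r,\frac12)$ (shot noise). With an ideal EPR pair, the joint distribution of $d=(d_x,d_p)$ and Bob's mode is $C\,\mathrm dd$ times the Wigner distribution of the coherent state $|z_0+d\rangle$; and the joint distribution of $(m_x,m_p)$ and the two answers is the product of $2C$ times Lebesgue measure and the law of $(R,R)$, where $R$ has exactly the honest law. So for every teleportation outcome both attackers give one and the same sample of the honest distribution. 3. For all $t\in[0,1]$, $u\ge0$: the honest answer has law $\mathcal N(\sqrt t\,r,\frac12+u)$, and the conclusion of 2 on the answers holds for the attack with simulated noise and this honest law. In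 $n$ rounds with arbitrary challenges $(\theta_i,r_i,r_i^\perp)$ and a fresh ideal pair in each round, given that the outcomes $(m_x,m_p)$ lie in arbitrary measurable windows $D_i$ of positive finite area, the joint law of all answers equals the honest one. In particular the probability of passing the verifiers' checks on the answers is exactly that of the honest prover. 4. With a two-mode squeezed vacuum of finite $\zeta\ge0$ instead of the ideal pair, both answers equal one sample of $\mathcal N(\sqrt t\,r,\frac12+u+te^{-2\zeta})$, and the law of the answers converges to the honest one in total variation as $\zeta\to\infty$. 5. If, on a line with signal speed 1, $V_1,V_2$ are at $v_1,v_2$ and Alice and Bob sit at $a,b$ with $v_1\le a\le p\le b\le v_2$ and act without delay, their answers reach $V_1$ and $V_2$ exactly when those of an honest prover at $p$ would. -/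

import Mathlib

open MeasureTheory ProbabilityTheory Filter Topology
open scoped NNReal ENNReal

noncomputable section

namespace CVQPV

/-! ### Phase space, Wigner functions and states -/

/-- The phase space of one mode; a point is `(x, p)`. -/
abbrev Mode : Type := ℝ × ℝ

/-- The Wigner function of the `N`-mode Gaussian state with covariance matrix `Γ` and displacement
vector `d`; the coordinates are ordered as `(x₁, p₁, …, x_N, p_N)`. -/
def gaussianWigner (N : ℕ) (Γ : Matrix (Fin (2 * N)) (Fin (2 * N)) ℝ) (d r : Fin (2 * N) → ℝ) : ℝ :=
  1 / (Real.pi ^ N * √Γ.det) * Real.exp (-((r - d) ⬝ᵥ (Γ⁻¹.mulVec (r - d))))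

/-- The Wigner function `W(x,p) = π⁻¹ ∫ e^{2ipy} ⟨x-y|ψ⟩⟨ψ|x+y⟩ dy` of a one-mode pure state with
wave function `ψ`. (The integral is real; `re` only changes the type.) -/
def wignerTransform (ψ : ℝ → ℂ) (z : Mode) : ℝ :=
  ((1 / Real.pi : ℂ) * ∫ y : ℝ,
    Complex.exp (2 * Complex.I * z.2 * y) * ψ (z.1 - y) * (starRingEnd ℂ) (ψ (z.1 + y))).re

/-- The wave function of the coherent state with quadratures `z₀ = (x₀, p₀)` (up to a global
phase), in units where the vacuum is `π^{-1/4} e^{-x²/2}`. -/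
def coherentWave (z₀ : Mode) (x : ℝ) : ℂ :=
  ((Real.pi ^ (-(1 / 4) : ℝ) : ℝ) : ℂ) *
    Complex.exp (-((x : ℂ) - z₀.1) ^ 2 / 2 + Complex.I * z₀.2 * x)

/-! All states below have a nonnegative Wigner function (or distribution) and are represented by
the corresponding measure `W dx dp` on phase space. -/

/-- The coherent state with quadratures `z₀`. -/
def coherentState (z₀ : Mode) : Measure Mode :=
  volume.withDensity fun z => ENNReal.ofReal (wignerTransform (coherentWave z₀) z)

/-- The coherent state with quadratures `z₀` after a channel with attenuation `t` and excess noise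
power `u`: displacement `√t z₀`, covariance matrix `(1 + 2u) 𝟙₂`. -/
def noisyCoherentState (t u : ℝ) (z₀ : Mode) : Measure Mode :=
  volume.withDensity fun z => ENNReal.ofReal
    (gaussianWigner 1 ((1 + 2 * u) • (1 : Matrix (Fin 2) (Fin 2) ℝ))
      ![√t * z₀.1, √t * z₀.2] ![z.1, z.2])

/-- Covariance matrix of the two-mode squeezed vacuum with squeezing parameter `ζ`. -/
def tmsvCov (ζ : ℝ) : Matrix (Fin 4) (Fin 4) ℝ :=
  !![Real.cosh (2 * ζ), 0, Real.sinh (2 * ζ), 0;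
     0, Real.cosh (2 * ζ), 0, -Real.sinh (2 * ζ);
     Real.sinh (2 * ζ), 0, Real.cosh (2 * ζ), 0;
     0, -Real.sinh (2 * ζ), 0, Real.cosh (2 * ζ)]

/-- The two-mode squeezed vacuum on the modes `(A, B)`. -/
def tmsvState (ζ : ℝ) : Measure (Mode × Mode) :=
  volume.withDensity fun z => ENNReal.ofReal
    (gaussianWigner 2 (tmsvCov ζ) 0 ![z.1.1, z.1.2, z.2.1, z.2.2])

/-- The ideal EPR pair on the modes `(A, B)`, with Wigner distribution
`C δ(x_a - x_b) δ(p_a + p_b)`. It is not normalizable: its total mass is infinite. -/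
def idealEPR (C : ℝ) : Measure (Mode × Mode) :=
  ENNReal.ofReal C • (volume : Measure Mode).map fun z => (z, (z.1, -z.2))

/-! ### Measurements -/

/-- The quadrature `x_θ` in the direction `θ`. -/
def quadrature (θ : ℝ) (z : Mode) : ℝ := z.1 * Real.cos θ + z.2 * Real.sin θ

/-- Outcome distribution of a homodyne measurement under angle `θ`: the marginal of the Wigner
distribution along `x_θ`. -/
def homodyne (θ : ℝ) (ρ : Measure Mode) : Measure ℝ := ρ.map (quadrature θ)

/-- The balanced beamsplitter, acting on the phase space of two modes. -/
def beamSplitter (z : Mode × Mode) : Mode × Mode :=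
  (√(1 / 2) • (z.1 + z.2), √(1 / 2) • (-z.1 + z.2))

/-- Teleportation without the final correction. The mode in state `ψ` is mixed with the `A` mode
of the pair; `p` is measured in the first output mode and `x` in the second. The result is the
joint distribution of the outcome `m = (m_x, m_p)` and of the `B` mode. -/
def teleport (ψ : Measure Mode) (epr : Measure (Mode × Mode)) : Measure ((ℝ × ℝ) × Mode) :=
  (ψ.prod epr).map fun w =>
    (((beamSplitter (w.1, w.2.1)).2.1, (beamSplitter (w.1, w.2.1)).1.2), w.2.2)

/-- The displacement `(d_x, d_p)` that the outcome `m` induces on the `B` mode. -/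
def displacement (m : ℝ × ℝ) : Mode := (√2 * m.1, -√2 * m.2)

/-! ### The protocol and the attack -/

/-- Quadratures of the coherent state prepared for the challenge `(θ, r, r⊥)`. -/
def challenge (θ r rp : ℝ) : Mode :=
  (r * Real.cos θ + rp * Real.sin θ, r * Real.sin θ - rp * Real.cos θ)

/-- The prover sends one value to both verifiers. -/
def toBoth (a : ℝ) : ℝ × ℝ := (a, a)

/-- Joint distribution of the outcome `m` of Alice (who teleports `ψ`) and of the outcome `μ` of
Bob (who homodynes his half of the pair under `θ`). -/
def attackOutcomes (ψ : Measure Mode) (epr : Measure (Mode × Mode)) (θ : ℝ) :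
    Measure ((ℝ × ℝ) × ℝ) :=
  (teleport ψ epr).map fun w => (w.1, quadrature θ w.2)

/-- Alice's answer to `V₁`: from her own outcome `m` and Bob's message `(θ, μ)`. -/
def aliceAnswer (m : ℝ × ℝ) (msg : ℝ × ℝ) : ℝ :=
  msg.2 - (displacement m).1 * Real.cos msg.1 - (displacement m).2 * Real.sin msg.1

/-- Bob's answer to `V₂`: from his own data `(θ, μ)` and Alice's message `(d_x, d_p)`. -/
def bobAnswer (own : ℝ × ℝ) (d : ℝ × ℝ) : ℝ :=
  own.2 - d.1 * Real.cos own.1 - d.2 * Real.sin own.1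

/-- Joint distribution of Alice's outcome `m` and of the two answers. -/
def attackRound (ψ : Measure Mode) (epr : Measure (Mode × Mode)) (θ : ℝ) :
    Measure ((ℝ × ℝ) × (ℝ × ℝ)) :=
  (attackOutcomes ψ epr θ).map fun w =>
    (w.1, (aliceAnswer w.1 (θ, w.2), bobAnswer (θ, w.2) (displacement w.1)))

/-- The same attack with simulated channel noise: one of the attackers draws an independent
`ξ ~ N(0, (1-t)/2 + u)` and forwards it with the other data; both report `√t r' + ξ`. -/
def noisyAttackRound (t u : ℝ) (ψ : Measure Mode) (epr : Measure (Mode × Mode)) (θ : ℝ) :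
    Measure ((ℝ × ℝ) × (ℝ × ℝ)) :=
  ((attackRound ψ epr θ).prod (gaussianReal 0 (Real.toNNReal ((1 - t) / 2 + u)))).map fun w =>
    (w.1.1, (√t * w.1.2.1 + w.2, √t * w.1.2.2 + w.2))

/-- The law of the two answers, given that Alice's outcome lies in the window `D`. -/
def answersGiven (M : Measure ((ℝ × ℝ) × (ℝ × ℝ))) (D : Set (ℝ × ℝ)) : Measure (ℝ × ℝ) :=
  (ProbabilityTheory.cond M (Prod.fst ⁻¹' D)).map Prod.snd

/-- The threshold `γ` for the score. -/
def threshold (n : ℕ) (ε : ℝ) : ℝ :=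
  1 + 2 / √n * √(Real.log (1 / ε)) + 2 / n * Real.log (1 / ε)

/-- The answers `(a i).1` to `V₁` and `(a i).2` to `V₂` that the verifiers accept (apart from
timing): the two verifiers hear the same value in each round, and the score is below `γ`. -/
def accepted (n : ℕ) (t u ε : ℝ) (r : Fin n → ℝ) : Set (Fin n → ℝ × ℝ) :=
  {a | (∀ i, (a i).1 = (a i).2) ∧
    1 / (n : ℝ) * ∑ i, ((a i).1 - r i * √t) ^ 2 / (1 / 2 + u) < threshold n ε}

/-! ### Timing (on a line, signal speed 1) -/

/-- Arrival time at `y` of a signal sent from `x` at time `s`. -/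
def arrival (s x y : ℝ) : ℝ := s + |y - x|

/-- Time at which a signal sent by the verifier at `v` towards the prover position `p`, timed so as
to arrive there at time `T`, passes the position `y`. -/
def intercept (T v p y : ℝ) : ℝ := arrival (T - |p - v|) v y

/-- Arrival time at the verifier `v` of the answer of an attacker sitting at `a`, whose accomplice
sits at `b`. The attacker intercepts the signal of `v`, the accomplice that of the other verifier
`v'`; each forwards classical data to the other at once. -/
def attackArrival (T v v' p a b : ℝ) : ℝ :=
  arrival (max (intercept T v p a) (arrival (intercept T v' p b) b a)) a v

end CVQPV

end

namespace CVQPV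

/-! ### Isotropic Gaussian measures on phase space -/

/-! All Wigner functions involved are nonnegative, so states are measures on phase space and the
whole attack is a linear change of variables followed by taking marginals.

Write `z` for the phase-space point of the intercepted mode. Undoing the beamsplitter factor, the
displacement is `d = (x_a - x_z, -(p_a + p_z))`; on the ideal pair `x_b = x_a` and `p_b = -p_a`, so
Bob's point is exactly `z + d`. Translation invariance of Lebesgue measure makes `d` uniform and
independent of `z` (`lintegral_teleport_idealEPR`). A quadrature is linear, so the missing
teleportation correction can be made on the classical outcome: `μ - x_θ(d) = x_θ(z)`, which is the
honest homodyne value (`attackRound_eq_map_teleport`, `attackRound_idealEPR`).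

For a channel, the attenuated shot noise `t/2` and the simulated `(1-t)/2 + u` add up to `1/2 + u`.
Since the outcome and the answers form a product measure, conditioning on a window changes nothing
(`answersGiven_prod`), and `n` rounds follow factor by factor.

For finite squeezing, half-sums and differences of the pair are independent Gaussians of variances
`e^{2ζ}/4` and `e^{-2ζ}` per coordinate (`tmsvState_eq_map`). Only the differences enter the answer,
as extra noise. The limit `ζ → ∞` is dominated convergence, both for the rescaled pair and for the
Gaussian densities of the answers. -/

/-- The Gaussian measure on phase space with mean `m` and covariance `v 𝟙₂`. -/
noncomputable def isotropicGaussian (m : Mode) (v : ℝ≥0) : Measure Mode :=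
  (gaussianReal m.1 v).prod (gaussianReal m.2 v)

instance isProbabilityMeasure_isotropicGaussian (m : Mode) (v : ℝ≥0) :
    IsProbabilityMeasure (isotropicGaussian m v) := by
  unfold isotropicGaussian; infer_instance

/-- The density of `isotropicGaussian`. -/
noncomputable def isotropicPDF (m : Mode) (v : ℝ≥0) (z : Mode) : ℝ :=
  1 / (2 * Real.pi * v) * Real.exp (-((z.1 - m.1) ^ 2 + (z.2 - m.2) ^ 2) / (2 * v))

theorem isotropicPDF_nonneg (m : Mode) (v : ℝ≥0) (z : Mode) : 0 ≤ isotropicPDF m v z := by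
  unfold isotropicPDF; positivity

@[fun_prop]
theorem measurable_isotropicPDF (m : Mode) (v : ℝ≥0) : Measurable (isotropicPDF m v) := by
  unfold isotropicPDF; fun_prop

theorem isotropicGaussian_eq_withDensity (m : Mode) {v : ℝ≥0} (hv : v ≠ 0) :
    isotropicGaussian m v = volume.withDensity fun z => ENNReal.ofReal (isotropicPDF m v z) := by
  rw [isotropicGaussian, gaussianReal_of_var_ne_zero _ hv, gaussianReal_of_var_ne_zero _ hv,
    prod_withDensity (measurable_gaussianPDF _ _) (measurable_gaussianPDF _ _),
    ← Measure.volume_eq_prod]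
  congr 1
  funext z
  rw [gaussianPDF, gaussianPDF, ← ENNReal.ofReal_mul (gaussianPDFReal_nonneg _ _ _)]
  congr 1
  simp only [gaussianPDFReal, isotropicPDF]
  rw [mul_mul_mul_comm, ← mul_inv, Real.mul_self_sqrt (by positivity), ← Real.exp_add, one_div]
  congr 2
  ring

theorem map_linearCombination_gaussianReal (m₁ m₂ a b : ℝ) (v₁ v₂ : ℝ≥0) :
    ((gaussianReal m₁ v₁).prod (gaussianReal m₂ v₂)).map (fun z => a * z.1 + b * z.2) =
      gaussianReal (a * m₁ + b * m₂) (Real.toNNReal (a ^ 2 * v₁ + b ^ 2 * v₂)) := by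
  have h : (fun z : ℝ × ℝ => a * z.1 + b * z.2) =
      (fun z : ℝ × ℝ => z.1 + z.2) ∘ Prod.map (fun x => a * x) (fun x => b * x) := rfl
  rw [h, ← Measure.map_map (by fun_prop) (by fun_prop),
    ← Measure.map_prod_map _ _ (by fun_prop) (by fun_prop), gaussianReal_map_const_mul,
    gaussianReal_map_const_mul]
  change Measure.conv _ _ = _
  rw [gaussianReal_conv_gaussianReal]
  congr 1
  apply NNReal.eq
  rw [Real.coe_toNNReal _ (by positivity)]
  rfl

/-- The direction `(cos θ, sin θ)` has unit length, so the variance does not depend on `θ`. -/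
theorem homodyne_isotropicGaussian (θ : ℝ) (m : Mode) (v : ℝ≥0) :
    homodyne θ (isotropicGaussian m v) = gaussianReal (quadrature θ m) v := by
  have h : quadrature θ = fun z : Mode => Real.cos θ * z.1 + Real.sin θ * z.2 := by
    funext z; simp only [quadrature]; ring
  rw [homodyne, isotropicGaussian, h, map_linearCombination_gaussianReal, ← add_mul,
    Real.cos_sq_add_sin_sq, one_mul, Real.toNNReal_coe]

theorem map_add_isotropicGaussian (m d : Mode) (v : ℝ≥0) :
    (isotropicGaussian m v).map (fun z => z + d) = isotropicGaussian (m + d) v := by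
  have h : (fun z : Mode => z + d) = Prod.map (fun x => x + d.1) (fun x => x + d.2) := rfl
  rw [h, isotropicGaussian, ← Measure.map_prod_map _ _ (by fun_prop) (by fun_prop),
    gaussianReal_map_add_const, gaussianReal_map_add_const]
  rfl

theorem map_smul_isotropicGaussian (c : ℝ) (v : ℝ≥0) :
    (isotropicGaussian 0 v).map (fun z => c • z) =
      isotropicGaussian 0 (Real.toNNReal (c ^ 2) * v) := by
  have h : (fun z : Mode => c • z) = Prod.map (fun x => c * x) (fun x => c * x) := rfl
  rw [h, isotropicGaussian, ← Measure.map_prod_map _ _ (by fun_prop) (by fun_prop),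
    gaussianReal_map_const_mul, gaussianReal_map_const_mul, isotropicGaussian]
  simp only [Prod.fst_zero, Prod.snd_zero, mul_zero]
  rw [Real.toNNReal_of_nonneg (sq_nonneg c)]

/-! ### Coherent states -/

/-- The exponents of the two wave-function factors combine to `-(x-x₀)² - y² - 2ip₀y`, which leaves
the Fourier transform of a Gaussian at frequency `2(p-p₀)`. -/
theorem wignerTransform_coherentWave (z₀ z : Mode) :
    wignerTransform (coherentWave z₀) z = isotropicPDF z₀ (1 / 2) z := by
  have hπ : ((Real.pi ^ (-(1 / 4) : ℝ) : ℝ) : ℂ) * ((Real.pi ^ (-(1 / 4) : ℝ) : ℝ) : ℂ) *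
      (((Real.pi : ℂ) / 1) ^ (1 / 2 : ℂ)) = 1 := by
    rw [div_one, show (1 / 2 : ℂ) = ((1 / 2 : ℝ) : ℂ) by push_cast; rfl,
      ← Complex.ofReal_cpow Real.pi_pos.le, ← Complex.ofReal_mul, ← Complex.ofReal_mul,
      ← Real.rpow_add Real.pi_pos, ← Real.rpow_add Real.pi_pos]
    norm_num
  have hint : (fun y : ℝ => Complex.exp (2 * Complex.I * z.2 * y) * coherentWave z₀ (z.1 - y) *
      (starRingEnd ℂ) (coherentWave z₀ (z.1 + y))) = fun y : ℝ =>
      (((Real.pi ^ (-(1 / 4) : ℝ) : ℝ) : ℂ) * ((Real.pi ^ (-(1 / 4) : ℝ) : ℝ) : ℂ) *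
        Complex.exp (-((z.1 : ℂ) - z₀.1) ^ 2)) *
      (Complex.exp (Complex.I * (2 * ((z.2 : ℂ) - z₀.2)) * y) *
        Complex.exp (-1 * (y : ℂ) ^ 2)) := by
    funext y
    simp only [coherentWave, map_mul, Complex.conj_ofReal, ← Complex.exp_conj]
    have key : Complex.exp (2 * Complex.I * z.2 * y) *
        Complex.exp (-(((z.1 - y : ℝ) : ℂ) - z₀.1) ^ 2 / 2 +
          Complex.I * z₀.2 * ((z.1 - y : ℝ) : ℂ)) *
        Complex.exp ((starRingEnd ℂ) (-(((z.1 + y : ℝ) : ℂ) - z₀.1) ^ 2 / 2 +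
          Complex.I * z₀.2 * ((z.1 + y : ℝ) : ℂ))) =
        Complex.exp (-((z.1 : ℂ) - z₀.1) ^ 2) *
          (Complex.exp (Complex.I * (2 * ((z.2 : ℂ) - z₀.2)) * y) *
            Complex.exp (-1 * (y : ℂ) ^ 2)) := by
      rw [← Complex.exp_add, ← Complex.exp_add, ← Complex.exp_add, ← Complex.exp_add]
      congr 1
      simp only [map_add, map_div₀, map_neg, map_pow, map_sub, map_mul, Complex.conj_ofReal,
        Complex.conj_I, Complex.conj_ofNat]
      push_cast
      ring
    linear_combination (((Real.pi ^ (-(1 / 4) : ℝ) : ℝ) : ℂ) *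
      ((Real.pi ^ (-(1 / 4) : ℝ) : ℝ) : ℂ)) * key
  rw [wignerTransform, hint, integral_const_mul,
    fourierIntegral_gaussian (b := 1) (by simp) (2 * ((z.2 : ℂ) - z₀.2))]
  have hval : (1 / (Real.pi : ℂ)) *
      ((((Real.pi ^ (-(1 / 4) : ℝ) : ℝ) : ℂ) * ((Real.pi ^ (-(1 / 4) : ℝ) : ℝ) : ℂ) *
        Complex.exp (-((z.1 : ℂ) - z₀.1) ^ 2)) *
      (((Real.pi : ℂ) / 1) ^ (1 / 2 : ℂ) *
        Complex.exp (-(2 * ((z.2 : ℂ) - z₀.2)) ^ 2 / (4 * 1)))) =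
      ((isotropicPDF z₀ (1 / 2) z : ℝ) : ℂ) := by
    have hexp : Complex.exp (-((z.1 : ℂ) - z₀.1) ^ 2) *
        Complex.exp (-(2 * ((z.2 : ℂ) - z₀.2)) ^ 2 / (4 * 1)) =
        Complex.exp (-(((z.1 : ℂ) - z₀.1) ^ 2 + ((z.2 : ℂ) - z₀.2) ^ 2)) := by
      rw [← Complex.exp_add]; congr 1; ring
    have hpdf : isotropicPDF z₀ (1 / 2) z =
        1 / Real.pi * Real.exp (-((z.1 - z₀.1) ^ 2 + (z.2 - z₀.2) ^ 2)) := by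
      simp [isotropicPDF, mul_comm]
    rw [hpdf]
    push_cast
    rw [← hexp]
    linear_combination (1 / (Real.pi : ℂ)) * (Complex.exp (-((z.1 : ℂ) - z₀.1) ^ 2) *
        Complex.exp (-(2 * ((z.2 : ℂ) - z₀.2)) ^ 2 / (4 * 1))) * hπ
  rw [hval, Complex.ofReal_re]

theorem coherentState_eq (z₀ : Mode) : coherentState z₀ = isotropicGaussian z₀ (1 / 2) := by
  rw [isotropicGaussian_eq_withDensity _ (by norm_num), coherentState]
  simp only [wignerTransform_coherentWave]

theorem noisyCoherentState_eq {t u : ℝ} (hu : 0 ≤ u) (z₀ : Mode) :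
    noisyCoherentState t u z₀ = isotropicGaussian (√t • z₀) (Real.toNNReal (1 / 2 + u)) := by
  rw [isotropicGaussian_eq_withDensity _ (by simp; linarith), noisyCoherentState]
  congr 1
  funext z
  congr 1
  have h0 : (1 + 2 * u) ≠ 0 := by positivity
  have hinv : ((1 + 2 * u) • (1 : Matrix (Fin 2) (Fin 2) ℝ))⁻¹ =
      (1 + 2 * u)⁻¹ • (1 : Matrix (Fin 2) (Fin 2) ℝ) := by
    apply Matrix.inv_eq_right_inv
    simp [h0]
  have hdet : ((1 + 2 * u) • (1 : Matrix (Fin 2) (Fin 2) ℝ)).det = (1 + 2 * u) ^ 2 := by simp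
  -- `gaussianWigner 1` is indexed by `Fin (2 * 1)`; restating it over `Fin 2` lets the inverse and
  -- the determinant be rewritten.
  change 1 / (Real.pi ^ 1 * √((1 + 2 * u) • (1 : Matrix (Fin 2) (Fin 2) ℝ)).det) * Real.exp
    (-((![z.1, z.2] - ![√t * z₀.1, √t * z₀.2]) ⬝ᵥ
      (((1 + 2 * u) • (1 : Matrix (Fin 2) (Fin 2) ℝ))⁻¹.mulVec
        (![z.1, z.2] - ![√t * z₀.1, √t * z₀.2])))) = _
  rw [hinv, hdet, Real.sqrt_sq (by positivity), isotropicPDF,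
    Real.coe_toNNReal _ (by positivity)]
  congr 1
  · congr 1; ring
  · congr 1
    simp [Matrix.smul_mulVec, dotProduct, Fin.sum_univ_two]
    field_simp

theorem quadrature_challenge (θ r rp : ℝ) : quadrature θ (challenge θ r rp) = r := by
  simp only [quadrature, challenge]
  linear_combination r * Real.sin_sq_add_cos_sq θ

theorem homodyne_coherentState (θ r rp : ℝ) :
    homodyne θ (coherentState (challenge θ r rp)) = gaussianReal r (1 / 2) := by
  rw [coherentState_eq, homodyne_isotropicGaussian, quadrature_challenge]

theorem homodyne_noisyCoherentState {t u : ℝ} (hu : 0 ≤ u) (θ r rp : ℝ) :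
    homodyne θ (noisyCoherentState t u (challenge θ r rp)) =
      gaussianReal (√t * r) (Real.toNNReal (1 / 2 + u)) := by
  rw [noisyCoherentState_eq hu, homodyne_isotropicGaussian]
  congr 1
  conv_rhs => rw [← quadrature_challenge θ r rp]
  simp only [quadrature, Prod.smul_fst, Prod.smul_snd, smul_eq_mul]
  ring

/-! ### Teleportation with the ideal pair -/

theorem measurable_quadrature (θ : ℝ) : Measurable (quadrature θ) := by
  unfold quadrature; fun_prop

theorem measurable_displacement : Measurable displacement := by
  unfold displacement; fun_prop

theorem measurable_toBoth : Measurable toBoth := by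
  unfold toBoth; fun_prop

theorem measurable_teleport_map : Measurable fun w : Mode × (Mode × Mode) =>
    (((beamSplitter (w.1, w.2.1)).2.1, (beamSplitter (w.1, w.2.1)).1.2), w.2.2) := by
  simp only [beamSplitter, Prod.fst_add, Prod.snd_add, Prod.smul_fst, Prod.smul_snd, Prod.fst_neg,
    smul_eq_mul]
  fun_prop

instance sFinite_idealEPR (C : ℝ) : SFinite (idealEPR C) := by
  unfold idealEPR; infer_instance

theorem sqrt_two_mul_sqrt_half (a : ℝ) : √2 * (√(1 / 2) * a) = a := by
  rw [← mul_assoc, ← Real.sqrt_mul (by norm_num)]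
  norm_num

/-- The phase-space reflection `(x, p) ↦ (x, -p)` preserves the volume. -/
theorem measurePreserving_reflect :
    MeasurePreserving (fun z : Mode => (z.1, -z.2)) volume volume :=
  (MeasurePreserving.id volume).prod (Measure.measurePreserving_neg (volume : Measure ℝ))

/-- With the ideal pair, the `B` mode is displaced by a uniformly distributed amount `d`. -/
theorem lintegral_teleport_idealEPR (ψ : Measure Mode) [SFinite ψ] (C : ℝ)
    {f : Mode × Mode → ℝ≥0∞} (hf : Measurable f) :
    ∫⁻ w, f (displacement w.1, w.2) ∂(teleport ψ (idealEPR C)) =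
      ENNReal.ofReal C * ∫⁻ z, (∫⁻ d : Mode, f (d, z + d)) ∂ψ := by
  have hfd : Measurable fun w : (ℝ × ℝ) × Mode => f (displacement w.1, w.2) :=
    hf.comp ((measurable_displacement.comp measurable_fst).prodMk measurable_snd)
  rw [teleport, lintegral_map hfd measurable_teleport_map,
    lintegral_prod _ (by exact (hfd.comp measurable_teleport_map).aemeasurable),
    ← lintegral_const_mul' _ _ ENNReal.ofReal_ne_top]
  congr 1
  funext z
  have hg : Measurable fun w : Mode × Mode =>
      f (displacement ((beamSplitter (z, w.1)).2.1, (beamSplitter (z, w.1)).1.2), w.2) :=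
    (hfd.comp measurable_teleport_map).comp measurable_prodMk_left
  rw [idealEPR, lintegral_smul_measure, lintegral_map hg (by fun_prop), smul_eq_mul]
  congr 1
  -- The factor `√2` in `displacement` cancels the beamsplitter's `√(1/2)`, leaving `d = b - z` with
  -- `b = (y.1, -y.2)` Bob's point.
  have hs : ∀ y : Mode,
      f (displacement ((beamSplitter (z, y)).2.1, (beamSplitter (z, y)).1.2), (y.1, -y.2)) =
        f ((y.1, -y.2) + -z, (y.1, -y.2)) := by
    intro y
    congr 2
    simp only [displacement, beamSplitter, Prod.fst_add, Prod.snd_add, Prod.smul_fst,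
      Prod.smul_snd, Prod.fst_neg, smul_eq_mul, neg_mul, sqrt_two_mul_sqrt_half]
    ext
    · simp [add_comm]
    · simp [add_comm]
  simp only [hs]
  rw [measurePreserving_reflect.lintegral_comp (f := fun y : Mode => f (y + -z, y)) (by fun_prop),
    ← lintegral_add_right_eq_self _ z]
  simp [add_comm]

/-- Fubini, together with the fact that a translated coherent state is again coherent. -/
theorem lintegral_teleport_coherentState (C : ℝ) (z₀ : Mode)
    {f : Mode × Mode → ℝ≥0∞} (hf : Measurable f) :
    ∫⁻ w, f (displacement w.1, w.2) ∂(teleport (coherentState z₀) (idealEPR C)) =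
      ENNReal.ofReal C * ∫⁻ d : Mode, ∫⁻ z, f (d, z) ∂(coherentState (z₀ + d)) := by
  simp only [coherentState_eq]
  rw [lintegral_teleport_idealEPR _ _ hf, lintegral_lintegral_swap (by fun_prop)]
  congr 2
  funext d
  rw [← map_add_isotropicGaussian, lintegral_map (by fun_prop) (by fun_prop)]

/-- By linearity of the quadrature, subtracting `x_θ(d)` from the outcome amounts to displacing the
mode by `-d` before measuring. Hence Bob can measure before he knows `d`. -/
theorem attackRound_eq_map_teleport (ψ : Measure Mode) (epr : Measure (Mode × Mode)) (θ : ℝ) :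
    attackRound ψ epr θ = (teleport ψ epr).map fun w =>
      (w.1, toBoth (quadrature θ (w.2 - displacement w.1))) := by
  have hq := measurable_quadrature θ
  have hd := measurable_displacement
  rw [attackRound, attackOutcomes, Measure.map_map _ (by fun_prop)]
  · congr 1
    funext w
    simp only [Function.comp, aliceAnswer, bobAnswer, toBoth, quadrature, Prod.fst_sub,
      Prod.snd_sub]
    congr 2 <;> ring
  · unfold aliceAnswer bobAnswer
    fun_prop

/-- The outcome `m` that induces the displacement `d`. -/
noncomputable def outcomeOf (d : Mode) : ℝ × ℝ := (√(1 / 2) * d.1, -√(1 / 2) * d.2)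

theorem measurable_outcomeOf : Measurable outcomeOf := by
  unfold outcomeOf; fun_prop

theorem outcomeOf_displacement (m : ℝ × ℝ) : outcomeOf (displacement m) = m := by
  have h : ∀ a : ℝ, √(1 / 2) * (√2 * a) = a := fun a => by
    rw [mul_left_comm, sqrt_two_mul_sqrt_half]
  ext <;> simp only [outcomeOf, displacement, neg_mul, mul_neg, neg_neg, h]

/-- This Jacobian is the source of the factor 2 in the density `2C` of the outcomes. -/
theorem map_outcomeOf_volume :
    (volume : Measure Mode).map outcomeOf = (2 : ℝ≥0∞) • volume := by
  have h : outcomeOf = Prod.map (fun x => √(1 / 2) * x) (fun x => -√(1 / 2) * x) := rfl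
  have h0 : √(1 / 2 : ℝ) ≠ 0 := by positivity
  rw [h, Measure.volume_eq_prod, ← Measure.map_prod_map _ _ (by fun_prop) (by fun_prop),
    Real.map_volume_mul_left h0, Real.map_volume_mul_left (neg_ne_zero.2 h0),
    Measure.prod_smul_left, Measure.prod_smul_right, smul_smul,
    ← ENNReal.ofReal_mul (abs_nonneg _), ← abs_mul, inv_neg, mul_neg, abs_neg, ← mul_inv,
    Real.mul_self_sqrt (by norm_num)]
  norm_num

theorem attackRound_idealEPR (ψ : Measure Mode) [SFinite ψ] (C θ : ℝ) :
    attackRound ψ (idealEPR C) θ =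
      (ENNReal.ofReal (2 * C) • (volume : Measure (ℝ × ℝ))).prod
        ((homodyne θ ψ).map toBoth) := by
  have hq := measurable_quadrature θ
  have hd := measurable_displacement
  have hb := measurable_toBoth
  have ho := measurable_outcomeOf
  refine Measure.ext_of_lintegral _ fun f hf => ?_
  have hG : Measurable fun w : Mode × Mode =>
      f (outcomeOf w.1, toBoth (quadrature θ (w.2 - w.1))) := by fun_prop
  have key := lintegral_teleport_idealEPR ψ C hG
  -- Here `d` cancels from the answer: `x_θ((z + d) - d) = x_θ(z)`.
  simp only [outcomeOf_displacement, add_sub_cancel_right] at key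
  rw [attackRound_eq_map_teleport, lintegral_map hf (by fun_prop), key, homodyne,
    Measure.map_map hb hq, lintegral_prod_symm _ hf.aemeasurable, lintegral_map _ (by fun_prop),
    ← lintegral_const_mul' _ _ ENNReal.ofReal_ne_top]
  · congr 1
    funext z
    rw [lintegral_smul_measure,
      ← lintegral_map (f := fun m => f (m, toBoth (quadrature θ z))) (by fun_prop) ho,
      map_outcomeOf_volume, lintegral_smul_measure, smul_eq_mul, smul_eq_mul, ← mul_assoc]
    congr 1
    rw [ENNReal.ofReal_mul zero_le_two, mul_comm]
    simp
  · exact Measurable.lintegral_prod_left hf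

/-! ### Simulated channel noise -/

/-- The law of `√t a + ξ`, where `a ~ ν` and `ξ ~ N(0, (1-t)/2 + u)` are independent. -/
noncomputable def addChannelNoise (t u : ℝ) (ν : Measure ℝ) : Measure ℝ :=
  (ν.prod (gaussianReal 0 (Real.toNNReal ((1 - t) / 2 + u)))).map fun w => √t * w.1 + w.2

theorem addChannelNoise_gaussianReal {t u : ℝ} (ht : 0 ≤ t) (ht1 : t ≤ 1) (hu : 0 ≤ u) (r : ℝ)
    (v : ℝ≥0) : addChannelNoise t u (gaussianReal r v) =
      gaussianReal (√t * r) (Real.toNNReal (t * v + (1 - t) / 2 + u)) := by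
  have h := map_linearCombination_gaussianReal r 0 (√t) 1 v (Real.toNNReal ((1 - t) / 2 + u))
  simp only [one_mul, mul_zero, add_zero, one_pow] at h
  rw [addChannelNoise, h, Real.sq_sqrt ht, Real.coe_toNNReal _ (by linarith), add_assoc]

/-- The noise is independent of the outcome and acts identically on the two equal answers, so it
commutes with `toBoth` and preserves the product form. -/
theorem noisyAttackRound_of_attackRound_eq_prod {t u θ : ℝ} {ψ : Measure Mode}
    {epr : Measure (Mode × Mode)} {μ : Measure (ℝ × ℝ)} {ν : Measure ℝ} [SFinite μ] [SFinite ν]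
    (h : attackRound ψ epr θ = μ.prod (ν.map toBoth)) :
    noisyAttackRound t u ψ epr θ = μ.prod ((addChannelNoise t u ν).map toBoth) := by
  have hb := measurable_toBoth
  have e₁ : μ.prod (ν.map toBoth) = (μ.prod ν).map (Prod.map id toBoth) := by
    rw [← Measure.map_prod_map _ _ measurable_id hb, Measure.map_id]
  have hid : ∀ η : Measure ℝ, η.map id = η := fun η => Measure.map_id
  rw [noisyAttackRound, h, e₁]
  conv_lhs => rw [← hid (gaussianReal 0 _)]
  rw [Measure.map_prod_map _ _ (by fun_prop) measurable_id,
    Measure.map_map (by fun_prop) (by fun_prop), addChannelNoise,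
    Measure.map_map hb (by fun_prop)]
  conv_rhs => rw [← Measure.map_id (μ := μ)]
  rw [Measure.map_prod_map _ _ measurable_id (by fun_prop), ← Measure.prodAssoc_prod,
    Measure.map_map (by fun_prop) (by fun_prop)]
  rfl

/-- The variant for finite squeezing, where only the marginal law of the answers is tracked. -/
theorem noisyAttackRound_map_snd_of_attackRound_map_snd {t u θ : ℝ} {ψ : Measure Mode}
    {epr : Measure (Mode × Mode)} {ν : Measure ℝ} [SFinite ν] [SFinite (attackRound ψ epr θ)]
    (h : (attackRound ψ epr θ).map Prod.snd = ν.map toBoth) :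
    (noisyAttackRound t u ψ epr θ).map Prod.snd = (addChannelNoise t u ν).map toBoth := by
  have hb := measurable_toBoth
  have hid : ∀ η : Measure ℝ, η.map id = η := fun η => Measure.map_id
  have e : (((attackRound ψ epr θ).map Prod.snd).prod
      (gaussianReal 0 (Real.toNNReal ((1 - t) / 2 + u)))) = ((attackRound ψ epr θ).prod
      (gaussianReal 0 (Real.toNNReal ((1 - t) / 2 + u)))).map (Prod.map Prod.snd id) := by
    rw [← Measure.map_prod_map _ _ measurable_snd measurable_id, hid]
  have e' : ((ν.map toBoth).prod (gaussianReal 0 (Real.toNNReal ((1 - t) / 2 + u)))) =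
      (ν.prod (gaussianReal 0 (Real.toNNReal ((1 - t) / 2 + u)))).map (Prod.map toBoth id) := by
    rw [← Measure.map_prod_map _ _ hb measurable_id, hid]
  have e'' := congrArg (Measure.map fun w : (ℝ × ℝ) × ℝ => (√t * w.1.1 + w.2, √t * w.1.2 + w.2))
    (e.symm.trans ((congrArg (fun η => Measure.prod η _) h).trans e'))
  rw [Measure.map_map (by fun_prop) (by fun_prop), Measure.map_map (by fun_prop) (by fun_prop)]
    at e''
  rw [noisyAttackRound, addChannelNoise, Measure.map_map (by fun_prop) (by fun_prop),
    Measure.map_map hb (by fun_prop)]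
  exact e''

/-- The window has finite positive mass, so conditioning normalizes to a probability measure even
when `μ` is infinite. -/
theorem answersGiven_prod (μ : Measure (ℝ × ℝ)) [SFinite μ] (ν : Measure (ℝ × ℝ))
    [IsProbabilityMeasure ν] {D : Set (ℝ × ℝ)} (h0 : μ D ≠ 0)
    (htop : μ D ≠ ∞) : answersGiven (μ.prod ν) D = ν := by
  have hD' : (Prod.fst ⁻¹' D : Set ((ℝ × ℝ) × (ℝ × ℝ))) = D ×ˢ Set.univ := by ext; simp
  rw [answersGiven, ProbabilityTheory.cond, hD', Measure.map_smul, ← Measure.prod_restrict,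
    Measure.restrict_univ, Measure.map_snd_prod, Measure.prod_prod, smul_smul]
  simp [ENNReal.inv_mul_cancel h0 htop]

/-! ### Two-mode squeezed vacuum -/

/-- The phase-space point of the pair with half-sums `q = ((x_a + x_b)/2, (p_a - p_b)/2)` and
differences `s = (x_a - x_b, p_a + p_b)`. -/
noncomputable def pairOf (w : Mode × Mode) : Mode × Mode :=
  ((w.1.1 + w.2.1 / 2, w.1.2 + w.2.2 / 2), (w.1.1 - w.2.1 / 2, w.2.2 / 2 - w.1.2))

theorem continuous_pairOf : Continuous pairOf := by
  unfold pairOf; fun_prop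

/-- The map is a composition of swaps, reflections and shears, each of which preserves volume. -/
theorem measurePreserving_pairOf : MeasurePreserving pairOf volume volume := by
  have h₁ : MeasurePreserving (fun w : Mode × Mode => (w.1, w.2 + (1 / 2 : ℝ) • w.1))
      (volume.prod volume) (volume.prod volume) :=
    (MeasurePreserving.id volume).skew_product (g := fun a c => c + (1 / 2 : ℝ) • a) (by fun_prop)
      (Eventually.of_forall fun a => map_add_right_eq_self _ _)
  have h₂ : MeasurePreserving (fun w : Mode × Mode => (w.1, -w.2 + w.1))
      (volume.prod volume) (volume.prod volume) :=
    (MeasurePreserving.id volume).skew_product (g := fun a c => -c + a) (by fun_prop)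
      (Eventually.of_forall fun a =>
        ((measurePreserving_add_right volume a).comp
          (Measure.measurePreserving_neg (volume : Measure Mode))).map_eq)
  have hswap : MeasurePreserving (Prod.swap : Mode × Mode → Mode × Mode)
      (volume.prod volume) (volume.prod volume) := Measure.measurePreserving_swap
  have h₃ : MeasurePreserving (Prod.map id fun z : Mode => (z.1, -z.2))
      ((volume : Measure Mode).prod volume) (volume.prod volume) :=
    (MeasurePreserving.id volume).prod measurePreserving_reflect
  have h := h₃.comp (h₂.comp (hswap.comp (h₁.comp hswap)))
  rw [← Measure.volume_eq_prod] at h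
  refine (funext fun w => ?_ : pairOf = _) ▸ h
  simp only [pairOf, Function.comp, Prod.swap, Prod.map, id]
  ext <;> (simp; try ring)

/-- Half-sums and differences diagonalize the covariance matrix. Its inverse is obtained by `ζ ↦
-ζ`, because `cosh² - sinh² = 1`. -/
theorem gaussianWigner_tmsvCov_pairOf (ζ : ℝ) (w : Mode × Mode) :
    gaussianWigner 2 (tmsvCov ζ) 0
        ![(pairOf w).1.1, (pairOf w).1.2, (pairOf w).2.1, (pairOf w).2.2] =
      isotropicPDF 0 (Real.toNNReal (Real.exp (2 * ζ) / 4)) w.1 *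
        isotropicPDF 0 (Real.toNNReal (Real.exp (-2 * ζ))) w.2 := by
  have hcs := Real.cosh_sq (2 * ζ)
  have hdet : (tmsvCov ζ).det = 1 := by
    simp [tmsvCov, Matrix.det_succ_row_zero, Fin.sum_univ_succ, Fin.succAbove]
    linear_combination (Real.cosh (2 * ζ) ^ 2 - Real.sinh (2 * ζ) ^ 2 + 1) * hcs
  have hinv : (tmsvCov ζ)⁻¹ = tmsvCov (-ζ) := by
    apply Matrix.inv_eq_right_inv
    ext i j
    fin_cases i <;> fin_cases j <;>
      simp [tmsvCov, Matrix.mul_apply, Fin.sum_univ_four] <;> linarith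
  change 1 / (Real.pi ^ 2 * √(tmsvCov ζ).det) * Real.exp
    (-((![(pairOf w).1.1, (pairOf w).1.2, (pairOf w).2.1, (pairOf w).2.2] - 0) ⬝ᵥ
      ((tmsvCov ζ)⁻¹.mulVec
        (![(pairOf w).1.1, (pairOf w).1.2, (pairOf w).2.1, (pairOf w).2.2] - 0)))) = _
  rw [hinv, hdet, sub_zero, isotropicPDF, isotropicPDF, Real.coe_toNNReal _ (by positivity),
    Real.coe_toNNReal _ (by positivity), mul_mul_mul_comm, ← Real.exp_add]
  have he : Real.exp (-2 * ζ) = (Real.exp (2 * ζ))⁻¹ := by rw [← Real.exp_neg]; congr 1; ring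
  have hne := (Real.exp_pos (2 * ζ)).ne'
  congr 1
  · rw [he, Real.sqrt_one]; field_simp; norm_num
  · congr 1
    simp [tmsvCov, dotProduct, Matrix.mulVec, Fin.sum_univ_four, pairOf]
    rw [Real.cosh_eq, Real.sinh_eq, Real.exp_neg]
    field_simp
    ring

theorem tmsvState_eq_map (ζ : ℝ) :
    tmsvState ζ = ((isotropicGaussian 0 (Real.toNNReal (Real.exp (2 * ζ) / 4))).prod
      (isotropicGaussian 0 (Real.toNNReal (Real.exp (-2 * ζ))))).map pairOf := by
  have hL := continuous_pairOf.measurable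
  have hρ : Measurable fun z : Mode × Mode => ENNReal.ofReal
      (gaussianWigner 2 (tmsvCov ζ) 0 ![z.1.1, z.1.2, z.2.1, z.2.2]) := by
    refine Measurable.ennreal_ofReal (Continuous.measurable ?_)
    unfold gaussianWigner
    have : Continuous fun z : Mode × Mode =>
        (![z.1.1, z.1.2, z.2.1, z.2.2] : Fin (2 * 2) → ℝ) := by
      refine continuous_pi fun i => ?_
      fin_cases i <;> simp <;> fun_prop
    fun_prop
  refine Measure.ext_of_lintegral _ fun f hf => ?_
  rw [isotropicGaussian_eq_withDensity _ (by simp; positivity),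
    isotropicGaussian_eq_withDensity _ (by simp; positivity),
    prod_withDensity (by fun_prop) (by fun_prop),
    lintegral_map hf hL, lintegral_withDensity_eq_lintegral_mul _ (by fun_prop) (by fun_prop),
    tmsvState, lintegral_withDensity_eq_lintegral_mul _ hρ hf,
    ← measurePreserving_pairOf.lintegral_comp (hρ.mul hf)]
  refine lintegral_congr fun w => ?_
  simp only [Pi.mul_apply]
  rw [gaussianWigner_tmsvCov_pairOf, ENNReal.ofReal_mul (isotropicPDF_nonneg _ _ _)]

instance isProbabilityMeasure_tmsvState (ζ : ℝ) : IsProbabilityMeasure (tmsvState ζ) := by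
  rw [tmsvState_eq_map]
  exact Measure.isProbabilityMeasure_map continuous_pairOf.measurable.aemeasurable

/-- The excess noise that teleportation with a squeezed vacuum adds to the quadrature `x_θ`. -/
theorem tmsvState_map_noise (θ ζ : ℝ) :
    (tmsvState ζ).map (fun z => quadrature θ (z.2.1 - z.1.1, z.2.2 + z.1.2)) =
      gaussianReal 0 (Real.toNNReal (Real.exp (-2 * ζ))) := by
  have hq := measurable_quadrature θ
  -- The half-sums, whose variance is large, drop out.
  have h : (fun z : Mode × Mode => quadrature θ (z.2.1 - z.1.1, z.2.2 + z.1.2)) ∘ pairOf =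
      (fun s : Mode => -Real.cos θ * s.1 + Real.sin θ * s.2) ∘ Prod.snd := by
    funext w
    simp only [quadrature, pairOf, Function.comp]
    ring
  rw [tmsvState_eq_map, Measure.map_map (by fun_prop) continuous_pairOf.measurable, h,
    ← Measure.map_map (by fun_prop) measurable_snd, Measure.map_snd_prod, measure_univ, one_smul,
    isotropicGaussian, map_linearCombination_gaussianReal, neg_sq, ← add_mul,
    Real.cos_sq_add_sin_sq, one_mul, Real.toNNReal_coe]
  simp

/-- The corrected point is `z + (x_b - x_a, p_b + p_a)`, and the pair is independent of `ψ`; hence a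
convolution. -/
theorem attackRound_tmsvState_map_snd (ψ : Measure Mode) [SFinite ψ] (θ ζ : ℝ) :
    (attackRound ψ (tmsvState ζ) θ).map Prod.snd =
      (Measure.conv (homodyne θ ψ)
        (gaussianReal 0 (Real.toNNReal (Real.exp (-2 * ζ))))).map toBoth := by
  have hq := measurable_quadrature θ
  have hd := measurable_displacement
  have hb := measurable_toBoth
  rw [attackRound_eq_map_teleport, teleport, Measure.map_map (by fun_prop) measurable_teleport_map,
    Measure.map_map (by fun_prop) ((by fun_prop : Measurable fun w : (ℝ × ℝ) × Mode =>
      (w.1, toBoth (quadrature θ (w.2 - displacement w.1)))).comp measurable_teleport_map),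
    homodyne, ← tmsvState_map_noise θ ζ, Measure.conv,
    Measure.map_prod_map _ _ hq (by fun_prop), Measure.map_map (by fun_prop) (by fun_prop),
    Measure.map_map (by fun_prop) (by fun_prop)]
  congr 1
  funext w
  simp only [Function.comp, Prod.map]
  congr 1
  simp only [displacement, beamSplitter, quadrature, Prod.fst_add, Prod.snd_add, Prod.fst_sub,
    Prod.snd_sub, Prod.smul_fst, Prod.smul_snd, Prod.fst_neg, smul_eq_mul, neg_mul,
    sqrt_two_mul_sqrt_half]
  ring

theorem noisyAttackRound_tmsvState_map_snd {t u : ℝ} (ht : 0 ≤ t) (ht1 : t ≤ 1) (hu : 0 ≤ u)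
    (θ r rp ζ : ℝ) :
    (noisyAttackRound t u (coherentState (challenge θ r rp)) (tmsvState ζ) θ).map Prod.snd =
      (gaussianReal (√t * r) (Real.toNNReal (1 / 2 + u + t * Real.exp (-2 * ζ)))).map toBoth := by
  have hψ : SFinite (coherentState (challenge θ r rp)) := by
    rw [coherentState_eq]; infer_instance
  have hs : SFinite (attackRound (coherentState (challenge θ r rp)) (tmsvState ζ) θ) := by
    rw [attackRound_eq_map_teleport, teleport]; infer_instance
  have h := attackRound_tmsvState_map_snd (coherentState (challenge θ r rp)) θ ζ
  rw [homodyne_coherentState, gaussianReal_conv_gaussianReal, add_zero] at h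
  rw [noisyAttackRound_map_snd_of_attackRound_map_snd h, addChannelNoise_gaussianReal ht ht1 hu]
  congr 3
  rw [NNReal.coe_add, Real.coe_toNNReal _ (Real.exp_pos _).le]
  push_cast
  ring

/-! ### The ideal pair as a limit -/

/-- Rescaling the differences by `e^{-ζ}` and cancelling the normalization of the wide Gaussian
against `(π/2) e^{2ζ}` moves all dependence on `ζ` into the integrand, ready for dominated
convergence. -/
theorem integral_tmsvState (ζ : ℝ) {f : Mode × Mode → ℝ} (hf : Continuous f) :
    Real.pi / 2 * Real.exp (2 * ζ) * ∫ z, f z ∂(tmsvState ζ) =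
      ∫ w : Mode × Mode, Real.exp (-2 * Real.exp (-2 * ζ) * (w.1.1 ^ 2 + w.1.2 ^ 2)) *
        f (pairOf (w.1, Real.exp (-ζ) • w.2))
        ∂((volume : Measure Mode).prod (isotropicGaussian 0 1)) := by
  have hL := continuous_pairOf
  have hs : isotropicGaussian 0 (Real.toNNReal (Real.exp (-2 * ζ))) =
      (isotropicGaussian 0 1).map fun s => Real.exp (-ζ) • s := by
    rw [map_smul_isotropicGaussian, mul_one, ← Real.exp_nat_mul]
    congr 3; push_cast; ring
  have hid : ∀ η : Measure Mode, η.map id = η := fun η => Measure.map_id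
  rw [tmsvState_eq_map, integral_map hL.measurable.aemeasurable
    hf.measurable.aestronglyMeasurable, hs]
  conv_lhs => rw [← hid (isotropicGaussian 0 (Real.toNNReal (Real.exp (2 * ζ) / 4)))]
  rw [Measure.map_prod_map _ _ measurable_id (by fun_prop), integral_map (by fun_prop)
    (by fun_prop), isotropicGaussian_eq_withDensity _ (by simp; positivity),
    prod_withDensity_left (by fun_prop), integral_withDensity_eq_integral_toReal_smul (by fun_prop)
      (Eventually.of_forall fun _ => ENNReal.ofReal_lt_top), ← integral_const_mul]
  congr 1
  funext w
  rw [ENNReal.toReal_ofReal (isotropicPDF_nonneg _ _ _), smul_eq_mul, ← mul_assoc]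
  congr 1
  have he : Real.exp (-2 * ζ) = (Real.exp (2 * ζ))⁻¹ := by rw [← Real.exp_neg]; congr 1; ring
  have hne := (Real.exp_pos (2 * ζ)).ne'
  rw [isotropicPDF, Real.coe_toNNReal _ (by positivity), he, ← mul_assoc]
  have hone : Real.pi / 2 * Real.exp (2 * ζ) * (1 / (2 * Real.pi * (Real.exp (2 * ζ) / 4))) = 1 := by
    field_simp; norm_num
  rw [hone, one_mul]
  congr 1
  simp only [Prod.fst_zero, Prod.snd_zero, sub_zero]
  field_simp
  ring

theorem tendsto_integral_tmsvState {f : Mode × Mode → ℝ} (hf : Continuous f)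
    (hc : HasCompactSupport f) :
    Tendsto (fun ζ : ℝ => Real.pi / 2 * Real.exp (2 * ζ) * ∫ z, f z ∂(tmsvState ζ)) atTop
      (𝓝 (∫ z, f z ∂(idealEPR 1))) := by
  have hL := continuous_pairOf
  obtain ⟨M, hM⟩ := hc.exists_bound_of_continuous hf
  have hM0 : 0 ≤ M := (norm_nonneg _).trans (hM 0)
  obtain ⟨R, hR⟩ := hc.isCompact.isBounded.subset_closedBall (0 : Mode × Mode)
  have hlim : ∫ z, f z ∂(idealEPR 1) =
      ∫ w : Mode × Mode, f (pairOf (w.1, 0))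
        ∂((volume : Measure Mode).prod (isotropicGaussian 0 1)) := by
    rw [idealEPR, ENNReal.ofReal_one, one_smul, integral_map (by fun_prop) (by fun_prop),
      integral_fun_fst (fun q : Mode => f (pairOf (q, 0)))]
    simp [pairOf]
  rw [hlim]
  simp only [integral_tmsvState _ hf]
  refine tendsto_integral_filter_of_dominated_convergence
    (fun w => (Metric.closedBall (0 : Mode) R).indicator (fun _ => M) w.1 * 1) ?_ ?_ ?_ ?_
  · exact Eventually.of_forall fun ζ => Continuous.aestronglyMeasurable (by fun_prop)
  · refine Eventually.of_forall fun ζ => Eventually.of_forall fun w => ?_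
    rw [norm_mul, Real.norm_of_nonneg (Real.exp_pos _).le, mul_one]
    have hexp : Real.exp (-2 * Real.exp (-2 * ζ) * (w.1.1 ^ 2 + w.1.2 ^ 2)) ≤ 1 := by
      rw [Real.exp_le_one_iff]
      have : 0 ≤ Real.exp (-2 * ζ) * (w.1.1 ^ 2 + w.1.2 ^ 2) := by positivity
      linarith
    by_cases hw : w.1 ∈ Metric.closedBall (0 : Mode) R
    · rw [Set.indicator_of_mem hw]
      exact (mul_le_of_le_one_left (norm_nonneg _) hexp).trans (hM _)
    · rw [Set.indicator_of_notMem hw]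
      -- Up to sign, the coordinates of the half-sum are averages of those of the two points, so if
      -- both points lie in the sup-norm ball of radius `R`, so does the half-sum.
      have hz : f (pairOf (w.1, Real.exp (-ζ) • w.2)) = 0 := by
        by_contra hne
        apply hw
        have hmem := hR (subset_tsupport f (Function.mem_support.2 hne))
        simp only [mem_closedBall_zero_iff, Prod.norm_def, sup_le_iff, pairOf, Real.norm_eq_abs,
          abs_le] at hmem ⊢
        obtain ⟨⟨⟨h1, h2⟩, h3, h4⟩, ⟨h5, h6⟩, h7, h8⟩ := hmem
        exact ⟨⟨by linarith, by linarith⟩, by linarith, by linarith⟩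
      simp [hz]
  · refine Integrable.mul_prod (f := (Metric.closedBall (0 : Mode) R).indicator fun _ => M)
      (g := fun _ => (1 : ℝ)) ?_ (integrable_const _)
    rw [integrable_indicator_iff Metric.isClosed_closedBall.measurableSet]
    exact integrableOn_const (isCompact_closedBall _ _).measure_lt_top.ne
  · refine Eventually.of_forall fun w => ?_
    have he : Tendsto (fun ζ : ℝ => Real.exp (-ζ)) atTop (𝓝 0) :=
      Real.tendsto_exp_neg_atTop_nhds_zero
    have he₂ : Tendsto (fun ζ : ℝ => Real.exp (-2 * ζ)) atTop (𝓝 0) :=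
      Real.tendsto_exp_atBot.comp (tendsto_id.const_mul_atTop_of_neg (by norm_num))
    have h₁ : Tendsto (fun ζ : ℝ => Real.exp (-2 * Real.exp (-2 * ζ) *
        (w.1.1 ^ 2 + w.1.2 ^ 2))) atTop (𝓝 1) := by
      have := (Real.continuous_exp.tendsto _).comp
        ((he₂.const_mul (-2)).mul_const (w.1.1 ^ 2 + w.1.2 ^ 2))
      simpa [Function.comp_def] using this
    have h₂ : Tendsto (fun ζ : ℝ => f (pairOf (w.1, Real.exp (-ζ) • w.2))) atTop
        (𝓝 (f (pairOf (w.1, 0)))) := by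
      have hs := he.smul_const w.2
      rw [zero_smul] at hs
      exact ((hf.comp hL).tendsto _).comp (tendsto_const_nhds.prodMk_nhds hs)
    simpa using h₁.mul h₂

/-! ### Total variation convergence of Gaussian laws -/

theorem abs_gaussianReal_real_sub_le (m : ℝ) {v w : ℝ≥0} (hv : v ≠ 0) (hw : w ≠ 0)
    (S : Set ℝ) :
    |(gaussianReal m v).real S - (gaussianReal m w).real S| ≤
      ∫ x, |gaussianPDFReal m v x - gaussianPDFReal m w x| := by
  have h : ∀ {v : ℝ≥0}, v ≠ 0 → (gaussianReal m v).real S = ∫ x in S, gaussianPDFReal m v x := by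
    intro v hv
    rw [Measure.real, gaussianReal_apply_eq_integral _ hv, ENNReal.toReal_ofReal]
    exact integral_nonneg fun x => gaussianPDFReal_nonneg _ _ _
  have hi := integrable_gaussianPDFReal m v
  have hi' := integrable_gaussianPDFReal m w
  rw [h hv, h hw, ← integral_sub hi.integrableOn hi'.integrableOn]
  refine abs_integral_le_integral_abs.trans ?_
  exact setIntegral_le_integral (hi.sub hi').abs (Eventually.of_forall fun x => abs_nonneg _)

theorem tendsto_integral_abs_gaussianPDFReal_sub {α : Type*} {l : Filter α}
    [l.IsCountablyGenerated] (m : ℝ) {v : ℝ≥0} (hv : v ≠ 0) {w : α → ℝ≥0}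
    (hw : Tendsto w l (𝓝 v)) :
    Tendsto (fun a => ∫ x, |gaussianPDFReal m (w a) x - gaussianPDFReal m v x|) l (𝓝 0) := by
  have hv' : (0 : ℝ) < v := by positivity
  -- Dominating function for `v/2 ≤ w ≤ 2v`: the lower bound controls the prefactor, the upper bound
  -- the exponent, and the 2 counts the two densities.
  have hint : Integrable fun x : ℝ => 2 * ((√(Real.pi * v))⁻¹ *
      Real.exp (-(4 * (v : ℝ))⁻¹ * (x - m) ^ 2)) :=
    (((integrable_exp_neg_mul_sq (b := (4 * (v : ℝ))⁻¹) (by positivity)).comp_sub_right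
      m).const_mul _).const_mul _
  have hb : ∀ w : ℝ≥0, (v : ℝ) / 2 ≤ w → (w : ℝ) ≤ 2 * v → ∀ x : ℝ,
      |gaussianPDFReal m w x| ≤ (√(Real.pi * v))⁻¹ * Real.exp (-(4 * (v : ℝ))⁻¹ * (x - m) ^ 2) := by
    intro w h₁ h₂ x
    have hw' : (0 : ℝ) < w := by linarith
    rw [abs_of_nonneg (gaussianPDFReal_nonneg _ _ _), gaussianPDFReal]
    refine mul_le_mul (inv_anti₀ (by positivity) (Real.sqrt_le_sqrt ?_)) (Real.exp_le_exp.2 ?_)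
      (Real.exp_pos _).le (by positivity)
    · nlinarith [Real.pi_pos]
    · rw [neg_div, neg_mul, neg_le_neg_iff, div_eq_inv_mul]
      exact mul_le_mul_of_nonneg_right (inv_anti₀ (by positivity) (by linarith)) (sq_nonneg _)
  have hwR : Tendsto (fun a => (w a : ℝ)) l (𝓝 (v : ℝ)) := NNReal.tendsto_coe.2 hw
  have h₁ := hwR.eventually (eventually_ge_nhds (half_lt_self hv'))
  have h₂ := hwR.eventually (eventually_le_nhds (show (v : ℝ) < 2 * v by linarith))
  have key := tendsto_integral_filter_of_dominated_convergence (μ := (volume : Measure ℝ))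
    (F := fun a x => |gaussianPDFReal m (w a) x - gaussianPDFReal m v x|) (f := fun _ => 0) _
    (l := l) (Eventually.of_forall fun a => ?_) ?_ hint ?_
  · simpa using key
  · exact ((measurable_gaussianPDFReal _ _).sub
      (measurable_gaussianPDFReal _ _)).abs.aestronglyMeasurable
  · filter_upwards [h₁, h₂] with a ha₁ ha₂
    refine Eventually.of_forall fun x => ?_
    rw [Real.norm_eq_abs, abs_abs, two_mul]
    exact (abs_sub _ _).trans (add_le_add (hb _ ha₁ ha₂ x)
      (hb v (by linarith) (by linarith) x))
  · refine Eventually.of_forall fun x => ?_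
    have hcont : Tendsto (fun a => gaussianPDFReal m (w a) x) l (𝓝 (gaussianPDFReal m v x)) := by
      unfold gaussianPDFReal
      refine Tendsto.mul (Tendsto.inv₀ ((Real.continuous_sqrt.tendsto _).comp
        (hwR.const_mul _)) (by positivity)) ((Real.continuous_exp.tendsto _).comp
          (tendsto_const_nhds.div (hwR.const_mul _) (by positivity)))
    simpa using (hcont.sub_const (gaussianPDFReal m v x)).abs

/-! ### Timing -/

/-- The accomplice's message just continues the path of the signal from `v₂`, and reaches `a` at `T
+ p - a`, no earlier than the direct signal at `T - p + a`. Adding the travel time `a - v₁` gives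
the honest arrival time. -/
theorem attackArrival_left {T v₁ v₂ p a b : ℝ} (h₁ : v₁ ≤ a) (h₂ : a ≤ p) (h₃ : p ≤ b)
    (h₄ : b ≤ v₂) : attackArrival T v₁ v₂ p a b = arrival T p v₁ := by
  simp only [attackArrival, arrival, intercept]
  rw [abs_of_nonneg (by linarith : 0 ≤ p - v₁), abs_of_nonneg (by linarith : 0 ≤ a - v₁),
    abs_of_nonpos (by linarith : p - v₂ ≤ 0), abs_of_nonpos (by linarith : b - v₂ ≤ 0),
    abs_of_nonpos (by linarith : a - b ≤ 0), abs_of_nonpos (by linarith : v₁ - a ≤ 0),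
    abs_of_nonpos (by linarith : v₁ - p ≤ 0), max_eq_right (by linarith)]
  ring

theorem attackArrival_right {T v₁ v₂ p a b : ℝ} (h₁ : v₁ ≤ a) (h₂ : a ≤ p) (h₃ : p ≤ b)
    (h₄ : b ≤ v₂) : attackArrival T v₂ v₁ p b a = arrival T p v₂ := by
  simp only [attackArrival, arrival, intercept]
  rw [abs_of_nonneg (by linarith : 0 ≤ p - v₁), abs_of_nonneg (by linarith : 0 ≤ a - v₁),
    abs_of_nonpos (by linarith : p - v₂ ≤ 0), abs_of_nonpos (by linarith : b - v₂ ≤ 0),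
    abs_of_nonneg (by linarith : 0 ≤ b - a), abs_of_nonneg (by linarith : 0 ≤ v₂ - b),
    abs_of_nonneg (by linarith : 0 ≤ v₂ - p), max_eq_right (by linarith)]
  ring

/-! ### The attack reproduces the honest law -/

theorem noisyAttackRound_idealEPR {t u : ℝ} (ht : 0 ≤ t) (ht1 : t ≤ 1) (hu : 0 ≤ u)
    (C θ r rp : ℝ) :
    noisyAttackRound t u (coherentState (challenge θ r rp)) (idealEPR C) θ =
      (ENNReal.ofReal (2 * C) • (volume : Measure (ℝ × ℝ))).prod
        ((homodyne θ (noisyCoherentState t u (challenge θ r rp))).map toBoth) := by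
  have hψ : SFinite (coherentState (challenge θ r rp)) := by
    rw [coherentState_eq]; infer_instance
  have h := attackRound_idealEPR (coherentState (challenge θ r rp)) C θ
  rw [homodyne_coherentState] at h
  rw [noisyAttackRound_of_attackRound_eq_prod h, addChannelNoise_gaussianReal ht ht1 hu,
    homodyne_noisyCoherentState hu]
  -- What remains is the variance identity `t/2 + (1-t)/2 + u = 1/2 + u`.
  congr 4
  push_cast
  ring

theorem answersGiven_noisyAttackRound_idealEPR {t u : ℝ} (ht : 0 ≤ t) (ht1 : t ≤ 1) (hu : 0 ≤ u)
    {C : ℝ} (hC : 0 < C) (θ r rp : ℝ) {D : Set (ℝ × ℝ)} (h0 : volume D ≠ 0)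
    (htop : volume D ≠ ∞) :
    answersGiven (noisyAttackRound t u (coherentState (challenge θ r rp)) (idealEPR C) θ) D =
      (homodyne θ (noisyCoherentState t u (challenge θ r rp))).map toBoth := by
  rw [noisyAttackRound_idealEPR ht ht1 hu, homodyne_noisyCoherentState hu]
  have : IsProbabilityMeasure ((gaussianReal (√t * r) (Real.toNNReal (1 / 2 + u))).map toBoth) :=
    Measure.isProbabilityMeasure_map measurable_toBoth.aemeasurable
  apply answersGiven_prod
  · simp only [Measure.smul_apply, smul_eq_mul]
    exact mul_ne_zero (by simpa using hC) h0
  · simp only [Measure.smul_apply, smul_eq_mul]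
    exact ENNReal.mul_ne_top ENNReal.ofReal_ne_top htop

theorem eventually_abs_noisyAttackRound_tmsvState_sub_le {t u : ℝ} (ht : 0 ≤ t) (ht1 : t ≤ 1)
    (hu : 0 ≤ u) (θ r rp : ℝ) {δ : ℝ} (hδ : 0 < δ) :
    ∀ᶠ ζ : ℝ in atTop, ∀ S : Set (ℝ × ℝ), MeasurableSet S →
      |((noisyAttackRound t u (coherentState (challenge θ r rp)) (tmsvState ζ) θ).map
          Prod.snd).real S -
        ((homodyne θ (noisyCoherentState t u (challenge θ r rp))).map toBoth).real S| ≤ δ := by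
  have he₂ : Tendsto (fun ζ : ℝ => Real.exp (-2 * ζ)) atTop (𝓝 0) :=
    Real.tendsto_exp_atBot.comp (tendsto_id.const_mul_atTop_of_neg (by norm_num))
  have hw : Tendsto (fun ζ : ℝ => Real.toNNReal (1 / 2 + u + t * Real.exp (-2 * ζ))) atTop
      (𝓝 (Real.toNNReal (1 / 2 + u))) := by
    have := (continuous_real_toNNReal.tendsto _).comp ((he₂.const_mul t).const_add (1 / 2 + u))
    simpa [Function.comp_def] using this
  have hv : Real.toNNReal (1 / 2 + u) ≠ 0 := (Real.toNNReal_pos.2 (by positivity)).ne'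
  have key := tendsto_integral_abs_gaussianPDFReal_sub (√t * r) hv hw
  filter_upwards [key.eventually (eventually_le_nhds hδ)] with ζ hζ S hS
  rw [noisyAttackRound_tmsvState_map_snd ht ht1 hu, homodyne_noisyCoherentState hu,
    map_measureReal_apply measurable_toBoth hS, map_measureReal_apply measurable_toBoth hS]
  exact (abs_gaussianReal_real_sub_le _ (Real.toNNReal_pos.2 (by positivity)).ne' hv _).trans hζ

end CVQPV

open CVQPV in
theorem mainTheorem3 :
    -- the ideal EPR pair is the (rescaled) limit of two-mode squeezed vacua
    (∀ f : Mode × Mode → ℝ, Continuous f → HasCompactSupport f →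
      Tendsto (fun ζ : ℝ => Real.pi / 2 * Real.exp (2 * ζ) * ∫ z, f z ∂(tmsvState ζ)) atTop
        (𝓝 (∫ z, f z ∂(idealEPR 1)))) ∧
    -- one round, for every challenge and ideal pair
    (∀ C θ r rp : ℝ, 0 < C →
      -- the honest prover: mean `r` and shot noise
      homodyne θ (coherentState (challenge θ r rp)) = gaussianReal r (1 / 2) ∧
      -- given the displacement `d`, Bob holds the coherent state displaced by `d`
      (∀ f : Mode × Mode → ℝ≥0∞, Measurable f →
        ∫⁻ w, f (displacement w.1, w.2) ∂(teleport (coherentState (challenge θ r rp)) (idealEPR C)) =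
          ENNReal.ofReal C * ∫⁻ d : Mode, ∫⁻ z, f (d, z) ∂(coherentState (challenge θ r rp + d))) ∧
      -- Alice's outcome is uniform, and whatever it is, both answers are one sample of the
      -- honest distribution
      attackRound (coherentState (challenge θ r rp)) (idealEPR C) θ =
        (ENNReal.ofReal (2 * C) • (volume : Measure (ℝ × ℝ))).prod
          ((homodyne θ (coherentState (challenge θ r rp))).map toBoth)) ∧
    -- channels with attenuation `t` and excess noise `u`
    (∀ t u : ℝ, 0 ≤ t → t ≤ 1 → 0 ≤ u →
      (∀ C θ r rp : ℝ, 0 < C →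
        homodyne θ (noisyCoherentState t u (challenge θ r rp)) =
          gaussianReal (√t * r) (Real.toNNReal (1 / 2 + u)) ∧
        noisyAttackRound t u (coherentState (challenge θ r rp)) (idealEPR C) θ =
          (ENNReal.ofReal (2 * C) • (volume : Measure (ℝ × ℝ))).prod
            ((homodyne θ (noisyCoherentState t u (challenge θ r rp))).map toBoth)) ∧
      -- `n` rounds: the answers have the honest law, hence the same acceptance probability
      (∀ (n : ℕ) (θ r rp C : Fin n → ℝ) (D : Fin n → Set (ℝ × ℝ)), (∀ i, 0 < C i) →
        (∀ i, MeasurableSet (D i)) → (∀ i, volume (D i) ≠ 0) → (∀ i, volume (D i) ≠ ∞) →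
        Measure.pi (fun i => answersGiven (noisyAttackRound t u
            (coherentState (challenge (θ i) (r i) (rp i))) (idealEPR (C i)) (θ i)) (D i)) =
          Measure.pi (fun i =>
            (homodyne (θ i) (noisyCoherentState t u (challenge (θ i) (r i) (rp i)))).map toBoth) ∧
        ∀ ε : ℝ, 0 < ε → ε < 1 →
          Measure.pi (fun i => answersGiven (noisyAttackRound t u
              (coherentState (challenge (θ i) (r i) (rp i))) (idealEPR (C i)) (θ i)) (D i))
              (accepted n t u ε r) =
            Measure.pi (fun i =>
              (homodyne (θ i) (noisyCoherentState t u (challenge (θ i) (r i) (rp i)))).map toBoth)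
              (accepted n t u ε r)) ∧
      -- finite squeezing: the answers have the law `N(√t r, 1/2 + u + t e^{-2ζ})`, which tends to
      -- the honest law in total variation as `ζ → ∞`
      (∀ θ r rp : ℝ,
        (∀ ζ : ℝ, 0 ≤ ζ →
          (noisyAttackRound t u (coherentState (challenge θ r rp)) (tmsvState ζ) θ).map Prod.snd =
            (gaussianReal (√t * r)
              (Real.toNNReal (1 / 2 + u + t * Real.exp (-2 * ζ)))).map toBoth) ∧
        ∀ δ : ℝ, 0 < δ → ∀ᶠ ζ : ℝ in atTop, ∀ S : Set (ℝ × ℝ), MeasurableSet S →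
          |((noisyAttackRound t u (coherentState (challenge θ r rp)) (tmsvState ζ) θ).map
              Prod.snd).real S -
            ((homodyne θ (noisyCoherentState t u (challenge θ r rp))).map toBoth).real S| ≤ δ)) ∧
    -- timing: the attackers' answers arrive when those of an honest prover at `p` would
    (∀ T v₁ v₂ p a b : ℝ, v₁ ≤ a → a ≤ p → p ≤ b → b ≤ v₂ →
      attackArrival T v₁ v₂ p a b = arrival T p v₁ ∧
      attackArrival T v₂ v₁ p b a = arrival T p v₂) := by
  refine ⟨fun f hf hc => tendsto_integral_tmsvState hf hc, fun C θ r rp _ =>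
    ⟨homodyne_coherentState θ r rp, fun f hf => lintegral_teleport_coherentState C _ hf, ?_⟩,
    fun t u ht ht1 hu => ⟨fun C θ r rp _ => ⟨homodyne_noisyCoherentState hu θ r rp,
      noisyAttackRound_idealEPR ht ht1 hu C θ r rp⟩, fun n θ r rp C D hC _ h0 htop => ?_,
      fun θ r rp => ⟨fun ζ _ => noisyAttackRound_tmsvState_map_snd ht ht1 hu θ r rp ζ,
        fun δ hδ => eventually_abs_noisyAttackRound_tmsvState_sub_le ht ht1 hu θ r rp hδ⟩⟩,
    fun T v₁ v₂ p a b h₁ h₂ h₃ h₄ =>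
      ⟨attackArrival_left h₁ h₂ h₃ h₄, attackArrival_right h₁ h₂ h₃ h₄⟩⟩
  · have : SFinite (coherentState (challenge θ r rp)) := by
      rw [coherentState_eq]; infer_instance
    exact attackRound_idealEPR _ C θ
  -- The product measures agree factor by factor, so the acceptance set needs no analysis.
  · have h := fun i => answersGiven_noisyAttackRound_idealEPR ht ht1 hu (hC i) (θ i) (r i) (rp i)
      (h0 i) (htop i)
    simp only [h, implies_true, and_self]
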